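/- Let $q$ be a prime power. A semioval in $\mathrm{PG}(2,q)$ is a non-empty set $\mathcal S$ of points such that through each point $P\in\mathcal S$ there is exactly one line $\ell$ with $\mathcal S\cap\ell=\{P\}$. A $k$-secant of $\mathcal S$ is a line meeting $\mathcal S$ in exactly $k$ points. A vertexless triangle is the set of points lying on at least one of the three lines that join two of three given non-collinear points, with these three points (the vertices) removed. Let $\mathcal S$ be a semioval in $\mathrm{PG}(2,q)$. If $\mathcal S$ has a $(q-1)$-secant and $$|\mathcal S|<\frac{5q}{2}-\frac{7}{2},$$ then $\mathcal S$ is contained in a vertexless triangle, and $\mathcal S$ has exactly two $(q-1)$-secants. -/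

import Mathlib

open scoped LinearAlgebra.Projectivization

/-- The points of `PG(2,q)`, where `q = |K|`, by homogeneous coordinates `(x : y : z)`. -/
abbrev PGPoint (K : Type*) [Field K] : Type _ := ℙ K (Fin 3 → K)

/-- The lines of `PG(2,q)`, where `q = |K|`, by homogeneous coordinates `[a : b : c]`. Incidence
`p ∈ l` is Mathlib's `Configuration.ofField` one: `(x : y : z)` lies on `[a : b : c]` iff
`x * a + y * b + z * c = 0`. -/
abbrev PGLine (K : Type*) [Field K] : Type _ := ℙ K (Fin 3 → K)

section PlaneGeometry

/-- `l` is a `k`-secant of the point set `S`: it meets `S` in exactly `k` points. -/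
def IsSecant {P L : Type*} [Membership P L] (k : ℕ) (S : Set P) (l : L) : Prop :=
  {x : P | x ∈ S ∧ x ∈ l}.encard = k

/-- `l` is a tangent to the point set `S` at `p`: it meets `S` in `p` and nowhere else. -/
def IsTangentAt {P L : Type*} [Membership P L] (S : Set P) (p : P) (l : L) : Prop :=
  {x : P | x ∈ S ∧ x ∈ l} = {p}

/-- A `t`-semiarc: a nonempty point set with exactly `t` tangents at each of its points. -/
def IsSemiarc {P : Type*} (L : Type*) [Membership P L] (t : ℕ) (S : Set P) : Prop :=
  S.Nonempty ∧ ∀ p ∈ S, {l : L | IsTangentAt S p l}.encard = t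

/-- A semioval: a `1`-semiarc. -/
def IsSemioval {P : Type*} (L : Type*) [Membership P L] (S : Set P) : Prop :=
  IsSemiarc L 1 S

/-- `T` is a vertexless triangle: the union of the three sides `a = BC`, `b = CA`, `c = AB` of a
triangle `ABC` (three non-collinear points), with the three vertices removed. -/
def IsVertexlessTriangle {P : Type*} (L : Type*) [Membership P L] (T : Set P) : Prop :=
  ∃ (A B C : P) (a b c : L),
    (A ∉ a ∧ A ∈ b ∧ A ∈ c) ∧ (B ∈ a ∧ B ∉ b ∧ B ∈ c) ∧ (C ∈ a ∧ C ∈ b ∧ C ∉ c) ∧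
    T = {x : P | x ∈ a ∨ x ∈ b ∨ x ∈ c} \ {A, B, C}

end PlaneGeometry

/-! Let the long secant `l` miss `S` exactly in `A` and `B`. Take `l` as line at infinity, `A` and
`B` as vertical and horizontal directions, and let `W` be the affine part of `S`. Uniqueness of
tangents says that in each of the q - 1 other directions exactly one line misses `W`; the crux is
that these missed lines concur.

On the vertical line x = x₀ let s_y count the missed lines through (x₀, y), so that the s_y sum to q
- 1. A Hankel determinant in y, of size s = s_{y₀}, is nonzero at y₀ and vanishes to order at least
s - s_y at each y, while vanishing power sums over the field keep its degree small
(`card_mul_le_of_coeff_sum_eq_zero`). The resulting quadratic inequality (`card_missed_mul_le`),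
with 2|W| + 6 ≤ 3q, forces s ≤ 1 or s > q/2. Two points of the second kind share two missed lines,
hence coincide (`missed_lines_concurrent`).

If `C` is the common point, incidence arguments put `S` on the sides of `ABC` and show that it fills
a second side (`IsSemioval.mem_sides_of_concurrent`). A third long secant would need too many points
(`encard_long_secants_eq_two`). -/

/-! ### Hankel determinants: multiplicity of roots against degree -/

section HankelDeterminant

open Polynomial Finset

variable {K : Type*} [Field K] [Fintype K]

/-- The `s × s` Hankel determinant with entries `∑ m, m ^ (i + j) * g m`. -/
noncomputable def hankelDet (g : K → K[X]) (s : ℕ) : K[X] :=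
  Matrix.det (Matrix.of fun i j : Fin s => ∑ m : K, C (m ^ ((i : ℕ) + (j : ℕ))) * g m)

/-- Multilinearity in the rows: `φ` picks one summand `m` for each row. -/
theorem hankelDet_eq_sum (g : K → K[X]) (s : ℕ) :
    hankelDet g s = ∑ φ : Fin s → K, (∏ i, g (φ i)) *
      Matrix.det (Matrix.of fun i j : Fin s => C (φ i ^ ((i : ℕ) + (j : ℕ)))) := by
  classical
  have h := (Matrix.detRowAlternating (n := Fin s) (R := K[X])).toMultilinearMap.map_sum
    (fun (i : Fin s) (m : K) (j : Fin s) => g m * C (m ^ ((i : ℕ) + (j : ℕ))))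
  have e : (Matrix.of fun i j : Fin s => ∑ m : K, C (m ^ ((i : ℕ) + (j : ℕ))) * g m) =
      fun i : Fin s => ∑ m : K, fun j : Fin s => g m * C (m ^ ((i : ℕ) + (j : ℕ))) := by
    ext1 i j
    simp [Finset.sum_apply, mul_comm]
  rw [hankelDet, e]
  refine h.trans (Finset.sum_congr rfl fun φ _ => ?_)
  rw [← Matrix.det_mul_column]
  rfl

/-- In the row expansion a non-injective `φ` gives two proportional rows, so contributes zero. An
injective `φ` selects each `g m` at most once, so all but at most s_y of its `s` factors vanish at
`y`. -/
theorem pow_dvd_hankelDet [DecidableEq K] (g : K → K[X]) (s : ℕ) (y : K) :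
    (X - C y) ^ (s - #{m : K | (g m).eval y ≠ 0}) ∣ hankelDet g s := by
  rw [hankelDet_eq_sum]
  refine Finset.dvd_sum fun φ _ => ?_
  by_cases hφ : Function.Injective φ
  · refine Dvd.dvd.mul_right ?_ _
    have h1 : #{i : Fin s | (g (φ i)).eval y ≠ 0} ≤ #{m : K | (g m).eval y ≠ 0} :=
      Finset.card_le_card_of_injOn φ (fun i hi => by simpa using hi) hφ.injOn
    have h2 := Finset.card_filter_add_card_filter_not (s := (univ : Finset (Fin s)))
      (fun i => (g (φ i)).eval y ≠ 0)
    rw [Finset.card_univ, Fintype.card_fin] at h2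
    have h3 : (X - C y) ^ #{i : Fin s | ¬ (g (φ i)).eval y ≠ 0} ∣ ∏ i, g (φ i) := by
      rw [← Finset.prod_const]
      refine (Finset.prod_dvd_prod_of_dvd _ (fun i => g (φ i)) fun i hi => ?_).trans
        (Finset.prod_dvd_prod_of_subset _ _ _ (Finset.filter_subset _ _))
      rw [dvd_iff_isRoot]
      simpa using hi
    exact (pow_dvd_pow _ (by omega)).trans h3
  · obtain ⟨i, j, hij, hne⟩ : ∃ i j, φ i = φ j ∧ i ≠ j := by
      simpa [Function.Injective] using hφ
    have : Matrix.det (Matrix.of fun i j : Fin s =>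
        (C (φ i ^ ((i : ℕ) + (j : ℕ))) : K[X])) = 0 := by
      have h := Matrix.det_mul_column (fun i : Fin s => (C (φ i ^ (i : ℕ)) : K[X]))
        (Matrix.of fun i j : Fin s => (C (φ i ^ (j : ℕ)) : K[X]))
      have hz : Matrix.det (Matrix.of fun i j : Fin s => (C (φ i ^ (j : ℕ)) : K[X])) = 0 :=
        Matrix.det_zero_of_row_eq hne (by ext1 k; simp [hij])
      rw [hz, mul_zero] at h
      rw [← h]
      congr 1
      ext1 i j
      simp [pow_add]
    rw [this, mul_zero]
    exact dvd_zero _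

/-- At `y` the matrix is VᵀDV, with V the Vandermonde matrix on the `m` where `g m` does not vanish
and D the diagonal of those nonzero values. -/
theorem eval_hankelDet_ne_zero [DecidableEq K] (g : K → K[X]) (y : K) :
    (hankelDet g #{m : K | (g m).eval y ≠ 0}).eval y ≠ 0 := by
  set T : Finset K := {m : K | (g m).eval y ≠ 0} with hT
  let f : Fin #T → K := fun i => (T.equivFin.symm i : K)
  have hf : Function.Injective f :=
    Subtype.val_injective.comp T.equivFin.symm.injective
  have h : (hankelDet g #T).eval y =
      Matrix.det ((Matrix.vandermonde f).transpose *
        (Matrix.of fun i j => (g (f i)).eval y * Matrix.vandermonde f i j)) := by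
    rw [hankelDet, ← coe_evalRingHom, RingHom.map_det]
    congr 1
    ext i j
    simp only [RingHom.mapMatrix_apply, Matrix.map_apply, Matrix.of_apply, coe_evalRingHom,
      eval_finsetSum, eval_mul, eval_C, Matrix.mul_apply, Matrix.transpose_apply,
      Matrix.vandermonde_apply]
    rw [← Finset.sum_subset (Finset.subset_univ T)
      (fun m _ hm => by
        have : (g m).eval y = 0 := by simpa [hT] using hm
        rw [this, mul_zero]),
      ← Finset.sum_coe_sort T, ← T.equivFin.symm.sum_comp]
    exact Finset.sum_congr rfl fun k _ => by simp only [f]; ring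
  rw [h, Matrix.det_mul, Matrix.det_transpose, Matrix.det_mul_column]
  have hv := Matrix.det_vandermonde_ne_zero_iff.2 hf
  refine mul_ne_zero hv (mul_ne_zero (Finset.prod_ne_zero_iff.2 fun i _ => ?_) hv)
  exact (Finset.mem_filter.1 (T.equivFin.symm i).2).2

/-- By `hg` a nonzero entry (i, j) has degree at most N + i + j - q. This is additive in i and j, so
all Leibniz terms share one bound, s(N - q) + s(s - 1), written here without subtraction. -/
theorem natDegree_hankelDet_le (g : K → K[X]) (s N q : ℕ)
    (hg : ∀ e k, N + e < q + k → (∑ m : K, C (m ^ e) * g m).coeff k = 0)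
    (h0 : hankelDet g s ≠ 0) :
    (hankelDet g s).natDegree + s * q + s ≤ s * N + s * s := by
  have hc := mt leadingCoeff_eq_zero.1 h0
  rw [leadingCoeff] at hc
  set d := (hankelDet g s).natDegree
  rw [hankelDet, Matrix.det_apply, finsetSum_coeff] at hc
  obtain ⟨σ, -, hσ⟩ := Finset.exists_ne_zero_of_sum_ne_zero hc
  have hσ' : (∏ i : Fin s, ∑ m : K, C (m ^ ((σ i : ℕ) + (i : ℕ))) * g m).coeff d ≠ 0 := by
    intro h
    apply hσ
    rw [Units.smul_def, coeff_smul]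
    simp only [Matrix.of_apply]
    rw [h, smul_zero]
  have hd := (le_natDegree_of_ne_zero hσ').trans (natDegree_prod_le _ _)
  have hne := Finset.prod_ne_zero_iff.1 (fun h => hσ' (by rw [h, coeff_zero]))
  have hi : ∀ i : Fin s, (∑ m : K, C (m ^ ((σ i : ℕ) + (i : ℕ))) * g m).natDegree + q ≤
      N + ((σ i : ℕ) + (i : ℕ)) := fun i => by
    by_contra hlt
    exact hne i (mem_univ i) (leadingCoeff_eq_zero.1 (hg _ _ (by omega)))
  have hsum := Finset.sum_le_sum fun i (_ : i ∈ (univ : Finset (Fin s))) => hi i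
  rw [sum_add_distrib, sum_add_distrib, sum_add_distrib,
    Equiv.sum_comp σ (fun i : Fin s => (i : ℕ))] at hsum
  simp only [sum_const, card_univ, Fintype.card_fin, smul_eq_mul] at hsum
  have hg2 := Finset.sum_range_id_mul_two s
  rw [← Fin.sum_univ_eq_sum_range (fun i => i)] at hg2
  have hs : s * (s - 1) + s = s * s := by
    cases s with
    | zero => rfl
    | succ n => simp; ring
  omega

/-- The powers of `X - C y` for distinct `y` are coprime, so the sum over `y` of s - s_y (truncated
at 0) is at most the degree of the determinant. -/
theorem card_mul_le_of_coeff_sum_eq_zero [DecidableEq K] (g : K → K[X]) (N q : ℕ)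
    (hg : ∀ e k, N + e < q + k → (∑ m : K, C (m ^ e) * g m).coeff k = 0) (y₀ : K) :
    Fintype.card K * #{m : K | (g m).eval y₀ ≠ 0} + #{m : K | (g m).eval y₀ ≠ 0} * q +
        #{m : K | (g m).eval y₀ ≠ 0} ≤
      ∑ y : K, #{m : K | (g m).eval y ≠ 0} + #{m : K | (g m).eval y₀ ≠ 0} * N +
        #{m : K | (g m).eval y₀ ≠ 0} * #{m : K | (g m).eval y₀ ≠ 0} := by
  set s := #{m : K | (g m).eval y₀ ≠ 0} with hs
  have h0 : hankelDet g s ≠ 0 := fun h => eval_hankelDet_ne_zero g y₀ (by rw [← hs, h, eval_zero])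
  have hdeg := natDegree_hankelDet_le g s N q hg h0
  have hdvd : ∏ y : K, (X - C y) ^ (s - #{m : K | (g m).eval y ≠ 0}) ∣ hankelDet g s :=
    Finset.prod_dvd_of_coprime
      (fun a _ b _ hab => (pairwise_coprime_X_sub_C Function.injective_id hab).pow)
      fun y _ => pow_dvd_hankelDet g s y
  have hle := natDegree_le_of_dvd hdvd h0
  rw [natDegree_prod_of_monic _ _ fun y _ => (monic_X_sub_C y).pow _] at hle
  simp only [natDegree_pow, natDegree_X_sub_C, mul_one] at hle
  have hsum : ∑ _y : K, s ≤ ∑ y : K, (s - #{m : K | (g m).eval y ≠ 0}) +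
      ∑ y : K, #{m : K | (g m).eval y ≠ 0} := by
    rw [← sum_add_distrib]
    exact Finset.sum_le_sum fun y _ => by omega
  rw [sum_const, card_univ, smul_eq_mul] at hsum
  omega

end HankelDeterminant

/-! ### Lines missing an affine point set -/

section MissedLines

open Polynomial Finset

variable {K : Type*} [Field K]

/-- The polynomial in `y` whose roots are the `y` for which the line of slope `m` through
`(x₀, y)` meets `W`. -/
noncomputable def meetPoly (W : Finset (K × K)) (x₀ m : K) : K[X] :=
  ∏ w ∈ W, (X + C ((w.1 - x₀) * m - w.2))

theorem eval_meetPoly_ne_zero (W : Finset (K × K)) (x₀ m y : K) :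
    (meetPoly W x₀ m).eval y ≠ 0 ↔ ∀ w ∈ W, w.2 ≠ y - m * x₀ + m * w.1 := by
  rw [meetPoly, eval_prod, Finset.prod_ne_zero_iff]
  refine forall₂_congr fun w _ => not_congr ?_
  rw [eval_add, eval_X, eval_C]
  constructor <;> intro h <;> linear_combination -h

/-- As a polynomial in `m`, the coefficient of X^k in `meetPoly W x₀ m` has degree at most #W - k,
so only power sums with exponent below q - 1 occur, and these vanish. -/
theorem coeff_sum_meetPoly [Fintype K] (W : Finset (K × K)) (x₀ : K) (e k : ℕ)
    (h : #W + e + 1 < Fintype.card K + k) :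
    (∑ m : K, C (m ^ e) * meetPoly W x₀ m).coeff k = 0 := by
  classical
  induction W using Finset.induction_on generalizing e k with
  | empty =>
    simp only [meetPoly, Finset.prod_empty, mul_one]
    rw [← map_sum, coeff_C]
    split_ifs with hk
    · subst hk
      exact FiniteField.sum_pow_lt_card_sub_one K e (by simp at h; omega)
    · rfl
  | insert w W hw ih =>
    rw [card_insert_of_notMem hw] at h
    have hp : ∑ m : K, C (m ^ e) * meetPoly (insert w W) x₀ m =
        X * ∑ m : K, C (m ^ e) * meetPoly W x₀ m +
        C (w.1 - x₀) * ∑ m : K, C (m ^ (e + 1)) * meetPoly W x₀ m -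
        C w.2 * ∑ m : K, C (m ^ e) * meetPoly W x₀ m := by
      rw [mul_sum, mul_sum, mul_sum, ← sum_add_distrib, ← sum_sub_distrib]
      refine Finset.sum_congr rfl fun m _ => ?_
      rw [meetPoly, Finset.prod_insert hw, ← meetPoly]
      simp only [map_pow, map_sub, map_mul]
      ring
    rw [hp, coeff_sub, coeff_add, coeff_C_mul, coeff_C_mul, ih _ _ (by omega), ih _ _ (by omega)]
    cases k with
    | zero => simp
    | succ k => rw [coeff_X_mul, ih e k (by omega), mul_zero, mul_zero, add_zero, sub_zero]

variable [Fintype K] [DecidableEq K]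

/-- A bound on the number `s` of missed lines through an affine point, when `W` misses exactly
one line in each direction `m ≠ 0`. -/
theorem card_missed_mul_le (W : Finset (K × K)) (b : K → K)
    (hb : ∀ m ≠ 0, ∀ c, (∀ w ∈ W, w.2 ≠ c + m * w.1) ↔ c = b m) (x₀ y₀ : K) :
    2 * (Fintype.card K * #{m : K | m ≠ 0 ∧ b m + m * x₀ = y₀}) + 1 ≤
      Fintype.card K + #{m : K | m ≠ 0 ∧ b m + m * x₀ = y₀} *
        (#W + 1 + #{m : K | m ≠ 0 ∧ b m + m * x₀ = y₀}) := by
  -- The factor `C m` discards slope 0, about which `hb` says nothing; it raises the degree in `m`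
  -- by one, whence `#W + 2` below.
  have hev : ∀ y : K, #{m : K | (C m * meetPoly W x₀ m).eval y ≠ 0} =
      #{m : K | m ≠ 0 ∧ b m + m * x₀ = y} := fun y => by
    congr 1
    ext m
    rw [Finset.mem_filter, Finset.mem_filter]
    refine and_congr_right fun _ => ?_
    rw [eval_mul, eval_C, mul_ne_zero_iff]
    refine and_congr_right fun hm => ?_
    rw [eval_meetPoly_ne_zero, hb m hm]
    constructor <;> intro h <;> linear_combination -h
  have key := card_mul_le_of_coeff_sum_eq_zero (fun m => C m * meetPoly W x₀ m) (#W + 2)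
    (Fintype.card K) (fun e k h => by
      have := coeff_sum_meetPoly W x₀ (e + 1) k (by omega)
      rw [← this]
      congr 1
      exact Finset.sum_congr rfl fun m _ => by rw [pow_succ, C_mul, mul_assoc]) y₀
  simp only [hev] at key
  -- Each of the q - 1 missed lines meets x = x₀ exactly once.
  have htot : ∑ y : K, #{m : K | m ≠ 0 ∧ b m + m * x₀ = y} + 1 = Fintype.card K := by
    have h1 : ∀ y : K, #{m : K | m ≠ 0 ∧ b m + m * x₀ = y} =
        #{m ∈ univ.erase (0 : K) | b m + m * x₀ = y} := fun y => by congr 1; ext m; simp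
    simp only [h1]
    rw [← Finset.card_eq_sum_card_fiberwise (fun _ _ => by simp), card_erase_of_mem (mem_univ _),
      card_univ]
    exact Nat.sub_add_cancel Fintype.card_pos
  nlinarith

theorem missed_lines_concurrent (W : Finset (K × K)) (hW : 2 * #W + 6 ≤ 3 * Fintype.card K)
    (b : K → K) (hb : ∀ m ≠ 0, ∀ c, (∀ w ∈ W, w.2 ≠ c + m * w.1) ↔ c = b m) :
    ∃ x₀ y₀, ∀ m ≠ 0, b m + m * x₀ = y₀ := by
  have big : ∀ x₀ y₀ m₁ m₂, m₁ ≠ 0 → m₂ ≠ 0 → m₁ ≠ m₂ → b m₁ + m₁ * x₀ = y₀ →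
      b m₂ + m₂ * x₀ = y₀ →
      Fintype.card K + 1 ≤ 2 * #{m : K | m ≠ 0 ∧ b m + m * x₀ = y₀} := by
    intro x₀ y₀ m₁ m₂ h₁ h₂ hne e₁ e₂
    have key := card_missed_mul_le W b hb x₀ y₀
    have h2 : 1 < #{m : K | m ≠ 0 ∧ b m + m * x₀ = y₀} :=
      Finset.one_lt_card.2 ⟨m₁, by simp [h₁, e₁], m₂, by simp [h₂, e₂], hne⟩
    set s := #{m : K | m ≠ 0 ∧ b m + m * x₀ = y₀}
    set q := Fintype.card K
    -- The inequality reads s² - (2q - 1 - #W)s + q - 1 ≥ 0. Its left side is convex in s and, by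
    -- `hW`, negative at s = 2 and s = q/2, so it fails for 2 ≤ s ≤ q/2.
    by_contra hlt
    obtain ⟨t, ht⟩ := Nat.exists_eq_add_of_lt h2
    obtain ⟨r, hr⟩ : ∃ r, q = 2 * (1 + t + 1) + r := ⟨q - 2 * (1 + t + 1), by omega⟩
    rw [hr, ht] at key
    rw [hr] at hW
    have := Nat.mul_le_mul_left (1 + t + 1) hW
    nlinarith [Nat.zero_le (t * r)]
  by_cases hK : ∃ m₁ m₂ : K, m₁ ≠ 0 ∧ m₂ ≠ 0 ∧ m₁ ≠ m₂
  swap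
  · push Not at hK
    exact ⟨0, b 1, fun m hm => by rw [hK m 1 hm one_ne_zero, mul_zero, add_zero]⟩
  obtain ⟨m₁, m₂, h₁, h₂, hne⟩ := hK
  have meet : ∀ m, m₁ ≠ m → ∃ x₀, b m + m * x₀ = b m₁ + m₁ * x₀ := fun m hm => by
    have := sub_ne_zero.2 hm
    refine ⟨(b m - b m₁) / (m₁ - m), ?_⟩
    field_simp
    ring
  obtain ⟨x₀, hx₀⟩ := meet m₂ hne
  refine ⟨x₀, b m₁ + m₁ * x₀, fun m hm => ?_⟩
  by_cases hm₁ : m₁ = m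
  · rw [hm₁]
  obtain ⟨x, hx⟩ := meet m hm₁
  have c₁ := big x₀ _ m₁ m₂ h₁ h₂ hne rfl hx₀
  have c₂ := big x _ m₁ m h₁ hm hm₁ rfl hx
  set T₁ : Finset K := {n : K | n ≠ 0 ∧ b n + n * x₀ = b m₁ + m₁ * x₀}
  set T₂ : Finset K := {n : K | n ≠ 0 ∧ b n + n * x = b m₁ + m₁ * x}
  -- Two sets of more than q/2 slopes among q - 1 share at least two, and two lines of different
  -- slopes meet only once.
  have hu : #(T₁ ∪ T₂) + 1 ≤ Fintype.card K := by
    have : T₁ ∪ T₂ ⊆ univ.erase 0 := fun n hn => by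
      simp only [T₁, T₂, mem_union, mem_filter] at hn
      rw [mem_erase]
      exact ⟨by tauto, mem_univ _⟩
    have := card_le_card this
    rw [card_erase_of_mem (mem_univ _), card_univ] at this
    have := Fintype.card_pos (α := K)
    omega
  have hi := card_union_add_card_inter T₁ T₂
  obtain ⟨n₁, k₁, n₂, k₂, hn⟩ := Finset.one_lt_card.1 (show 1 < #(T₁ ∩ T₂) by omega)
  simp only [T₁, T₂, mem_inter, mem_filter, mem_univ, true_and] at k₁ k₂
  have : (n₁ - n₂) * (x - x₀) = 0 := by
    linear_combination k₁.2.2 - k₁.1.2 - k₂.2.2 + k₂.1.2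
  have hxx : x = x₀ := by
    rcases mul_eq_zero.1 this with h | h
    · exact absurd (sub_eq_zero.1 h) hn
    · exact sub_eq_zero.1 h
  rw [← hxx, hx]

end MissedLines

/-! ### Affine coordinates, and concurrency of the tangents -/

section Coordinates

open Projectivization Configuration

variable {K : Type*} [Field K]

theorem exists_basis_adapted_to_line {a b w : Fin 3 → K} (hab : LinearIndependent K ![b, a])
    (hw : w ≠ 0) (ha : a ⬝ᵥ w = 0) (hb : b ⬝ᵥ w = 0) :
    ∃ v : Module.Basis (Fin 3) K (Fin 3 → K), v 0 = b ∧ v 1 = a ∧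
      ∀ u, u ⬝ᵥ w = v.repr u 2 := by
  obtain ⟨i, hi⟩ := Function.ne_iff.1 hw
  have hi' : w i ≠ 0 := hi
  set c : Fin 3 → K := Pi.single i (w i)⁻¹
  have hc : c ⬝ᵥ w = 1 := by simp [c, hi']
  have hli : LinearIndependent K ![b, a, c] := by
    rw [Fintype.linearIndependent_iff]
    intro g hg
    simp only [Fin.sum_univ_three, Matrix.cons_val_zero, Matrix.cons_val_one,
      Matrix.cons_val] at hg
    have h2 : g 2 = 0 := by
      have := congrArg (· ⬝ᵥ w) hg
      simpa [add_dotProduct, smul_dotProduct, ha, hb, hc] using this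
    rw [h2, zero_smul, add_zero] at hg
    obtain ⟨h0, h1⟩ := LinearIndependent.pair_iff.1 hab _ _ hg
    intro j
    fin_cases j <;> assumption
  refine ⟨basisOfLinearIndependentOfCardEqFinrank hli (by simp), by simp, by simp, fun u => ?_⟩
  set v := basisOfLinearIndependentOfCardEqFinrank hli (by simp)
  conv_lhs => rw [← v.sum_repr u]
  simp [v, Fin.sum_univ_three, add_dotProduct, smul_dotProduct, ha, hb, hc]

/-- Affine coordinates on the complement of a line `l`, with the directions `A` (vertical) and
`B` (horizontal) at two prescribed points of `l`. -/
theorem exists_affine_coordinates {A B : PGPoint K} {l : PGLine K} (hAB : A ≠ B)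
    (hA : A ∈ l) (hB : B ∈ l) :
    ∃ (pt : K → K → PGPoint K) (dir : K → PGPoint K) (line : K → K → PGLine K),
      (∀ p : PGPoint K, p ∉ l → ∃ x y, p = pt x y) ∧
      (∀ x y, pt x y ∉ l) ∧
      (∀ x y x' y', pt x y = pt x' y' → x = x' ∧ y = y') ∧
      (∀ p : PGPoint K, p ∈ l → p ≠ A → p ≠ B → ∃ m, m ≠ 0 ∧ p = dir m) ∧
      (∀ m, m ≠ 0 → dir m ∈ l ∧ dir m ≠ A ∧ dir m ≠ B) ∧
      (∀ m c, dir m ∈ line m c) ∧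
      (∀ x y m c, pt x y ∈ line m c ↔ y = c + m * x) ∧
      (∀ m (t : PGLine K), dir m ∈ t → t ≠ l → ∃ c, t = line m c) := by
  induction A using Projectivization.ind with | h a ha0 =>
  induction B using Projectivization.ind with | h b hb0 =>
  induction l using Projectivization.ind with | h w hw =>
  have hli : LinearIndependent K ![b, a] := by
    rw [LinearIndependent.pair_iff' hb0]
    exact fun k hk => hAB ((mk_eq_mk_iff' _ _ _ _ _).2 ⟨k, hk⟩)
  obtain ⟨v, hv0, hv1, hvw⟩ := exists_basis_adapted_to_line hli hw hA hB
  have hcomb : ∀ (x y z : K) i, v.repr (x • v 0 + y • v 1 + z • v 2) i = ![x, y, z] i := by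
    intro x y z i
    simp only [map_add, map_smul, v.repr_self, Finsupp.add_apply, Finsupp.smul_apply]
    fin_cases i <;> simp
  have hexp : ∀ u, u = v.repr u 0 • v 0 + v.repr u 1 • v 1 + v.repr u 2 • v 2 := fun u => by
    conv_lhs => rw [← v.sum_repr u, Fin.sum_univ_three]
  have hne : ∀ x y z : K, ![x, y, z] ≠ 0 → x • v 0 + y • v 1 + z • v 2 ≠ 0 := by
    intro x y z h h0
    apply h
    ext i
    rw [← hcomb, h0]
    simp
  have hp : ∀ x y : K, ![x, y, 1] ≠ 0 := fun x y h => by simpa using congrFun h 2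
  have hd : ∀ m : K, ![1, m, 0] ≠ 0 := fun m h => by simpa using congrFun h 0
  -- The line y = mx + c as a functional; `e` turns it into the vector of its line coordinates.
  let φ : K → K → Module.Dual K (Fin 3 → K) := fun m c => v.coord 1 - m • v.coord 0 - c • v.coord 2
  let e := (dotProductEquiv K (Fin 3)).symm
  have he : ∀ (f : Module.Dual K (Fin 3 → K)) u, u ⬝ᵥ e f = f u := fun f u => by
    rw [dotProduct_comm]
    exact congrArg (fun g : Module.Dual K (Fin 3 → K) => g u)
      ((dotProductEquiv K (Fin 3)).apply_symm_apply f)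
  have hφ : ∀ m c, e (φ m c) ≠ 0 := fun m c h => by
    have := he (φ m c) (v 1)
    rw [h] at this
    simp [φ] at this
  refine ⟨fun x y => mk K _ (hne x y 1 (hp x y)), fun m => mk K _ (hne 1 m 0 (hd m)),
    fun m c => mk K _ (hφ m c), ?_, ?_, ?_, ?_, ?_, ?_, ?_, ?_⟩
  · intro p hpl
    induction p using Projectivization.ind with | h u hu =>
    have hz : v.repr u 2 ≠ 0 := fun h => hpl (by
      change u ⬝ᵥ w = 0
      rw [hvw, h])
    refine ⟨v.repr u 0 / v.repr u 2, v.repr u 1 / v.repr u 2,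
      (mk_eq_mk_iff' _ _ _ _ _).2 ⟨v.repr u 2, ?_⟩⟩
    conv_rhs => rw [hexp u]
    simp only [smul_add, smul_smul, mul_div_cancel₀ _ hz, mul_one]
  · intro x y h
    change _ ⬝ᵥ w = 0 at h
    rw [hvw, hcomb] at h
    simp at h
  · intro x y x' y' h
    obtain ⟨k, hk⟩ := (mk_eq_mk_iff' _ _ _ _ _).1 h
    have hk' : ∀ i, k * ![x', y', 1] i = ![x, y, 1] i := fun i => by
      rw [← hcomb, ← hcomb, ← hk, map_smul]
      rfl
    have h2 := hk' 2
    have h1 := hk' 1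
    have h0 := hk' 0
    simp only [Matrix.cons_val, mul_one] at h2
    simp only [h2, one_mul, Matrix.cons_val] at h1 h0
    exact ⟨h0.symm, h1.symm⟩
  · intro p hpl hpA hpB
    induction p using Projectivization.ind with | h u hu =>
    have hz : v.repr u 2 = 0 := by rw [← hvw]; exact hpl
    have hu' := hexp u
    rw [hz, zero_smul, add_zero, hv0, hv1] at hu'
    have hx : v.repr u 0 ≠ 0 := fun h => hpA ((mk_eq_mk_iff' _ _ _ _ _).2
      ⟨v.repr u 1, by rw [h, zero_smul, zero_add] at hu'; exact hu'.symm⟩)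
    have hy : v.repr u 1 ≠ 0 := fun h => hpB ((mk_eq_mk_iff' _ _ _ _ _).2
      ⟨v.repr u 0, by rw [h, zero_smul, add_zero] at hu'; exact hu'.symm⟩)
    refine ⟨v.repr u 1 / v.repr u 0, div_ne_zero hy hx,
      (mk_eq_mk_iff' _ _ _ _ _).2 ⟨v.repr u 0, ?_⟩⟩
    conv_rhs => rw [hu']
    simp only [smul_add, smul_smul, mul_div_cancel₀ _ hx, mul_one, zero_smul, add_zero,
      hv0, hv1]
  · intro m hm
    refine ⟨?_, fun h => ?_, fun h => ?_⟩
    · change _ ⬝ᵥ w = 0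
      rw [hvw, hcomb]
      simp
    · obtain ⟨k, hk⟩ := (mk_eq_mk_iff' _ _ _ _ _).1 h
      have := congrArg (fun u => v.repr u 0) hk
      simp only [hcomb] at this
      rw [← hv1] at this
      simp at this
    · obtain ⟨k, hk⟩ := (mk_eq_mk_iff' _ _ _ _ _).1 h
      have := congrArg (fun u => v.repr u 1) hk
      simp only [hcomb] at this
      rw [← hv0] at this
      simp at this
      exact hm this.symm
  · intro m c
    change _ ⬝ᵥ _ = 0
    rw [he]
    simp [φ]
  · intro x y m c
    change _ ⬝ᵥ _ = 0 ↔ _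
    rw [he]
    simp only [φ, LinearMap.sub_apply, LinearMap.smul_apply, Module.Basis.coord_apply, hcomb,
      smul_eq_mul, Matrix.cons_val]
    constructor <;> intro h <;> linear_combination h
  · intro m t ht htl
    induction t using Projectivization.ind with | h n hn =>
    change _ ⬝ᵥ n = 0 at ht
    simp only [add_dotProduct, smul_dotProduct, one_smul, zero_smul, add_zero, smul_eq_mul] at ht
    -- Otherwise `t` contains both `A` and `B`, hence equals `l`.
    have hn1 : v 1 ⬝ᵥ n ≠ 0 := fun h => by
      rw [h, mul_zero, add_zero] at ht
      apply htl
      refine (ofField.eq_or_eq_of_orthogonal (a := mk K a ha0) (b := mk K b hb0) ?_ ?_ hA hB).resolve_left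
        hAB
      · change a ⬝ᵥ n = 0
        rw [← hv1, h]
      · change b ⬝ᵥ n = 0
        rw [← hv0, ht]
    refine ⟨-(v 2 ⬝ᵥ n) / (v 1 ⬝ᵥ n), (mk_eq_mk_iff' _ _ _ _ _).2 ⟨v 1 ⬝ᵥ n, ?_⟩⟩
    refine dotProduct_eq _ _ fun u => ?_
    rw [smul_dotProduct, dotProduct_comm _ u, he, dotProduct_comm n u]
    conv_rhs => rw [hexp u]
    simp only [φ, LinearMap.sub_apply, LinearMap.smul_apply, Module.Basis.coord_apply,
      smul_eq_mul, add_dotProduct, smul_dotProduct]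
    field_simp
    linear_combination (-(v.repr u 0)) * ht

theorem IsSemioval.existsUnique_tangent {P L : Type*} [Membership P L] {S : Set P}
    (hS : IsSemioval L S) {p : P} (hp : p ∈ S) : ∃! t : L, IsTangentAt S p t := by
  obtain ⟨t, ht⟩ := Set.encard_eq_one.1 (by simpa using hS.2 p hp)
  have ht' : ∀ x : L, IsTangentAt S p x ↔ x = t := fun x => by
    have := Set.ext_iff.1 ht x
    simpa using this
  exact ⟨t, (ht' t).2 rfl, fun y hy => (ht' y).1 hy⟩

theorem isTangentAt_iff {P L : Type*} [Membership P L] {S : Set P} {p : P} {t : L} :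
    IsTangentAt S p t ↔ p ∈ S ∧ p ∈ t ∧ ∀ x ∈ S, x ∈ t → x = p := by
  rw [IsTangentAt, Set.eq_singleton_iff_unique_mem]
  simp only [Set.mem_ofPred_eq, and_imp, and_assoc]

/-- The tangents at the points of a long secant of a small semioval are concurrent. -/
theorem tangents_concurrent [Finite K] {S : Set (PGPoint K)} (hS : IsSemioval (PGLine K) S)
    {A B : PGPoint K} {l : PGLine K} (hAB : A ≠ B) (hA : A ∈ l) (hB : B ∈ l)
    (hl : ∀ p : PGPoint K, p ∈ l → (p ∈ S ↔ p ≠ A ∧ p ≠ B))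
    (hlt : ∀ p : PGPoint K, ¬ IsTangentAt S p l)
    (hcard : 2 * (S \ {p | p ∈ l}).ncard + 6 ≤ 3 * Nat.card K) :
    ∃ C : PGPoint K, C ∉ l ∧ ∀ p ∈ S, p ∈ l → ∀ t : PGLine K, IsTangentAt S p t → C ∈ t := by
  classical
  have := Fintype.ofFinite K
  obtain ⟨pt, dir, line, hpt, hptl, hinj, hdir, hdirl, hdl, hpl, hline⟩ :=
    exists_affine_coordinates hAB hA hB
  let W : Finset (K × K) := {w | pt w.1 w.2 ∈ S}
  have hWmem : ∀ x y, (x, y) ∈ W ↔ pt x y ∈ S := fun x y => by simp [W]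
  have hW : W.card ≤ (S \ {p | p ∈ l}).ncard := by
    rw [← Set.ncard_coe_finset W]
    refine Set.ncard_le_ncard_of_injOn (fun w => pt w.1 w.2) (fun w hw => ?_) ?_ (Set.toFinite _)
    · exact ⟨(hWmem _ _).1 hw, hptl _ _⟩
    · intro w _ w' _ h
      exact Prod.ext_iff.2 (hinj _ _ _ _ h)
  have hdS : ∀ m, m ≠ 0 → dir m ∈ S := fun m hm =>
    (hl _ (hdirl m hm).1).2 (hdirl m hm).2
  have hll : ∀ m c, line m c ≠ l := fun m c h =>
    hptl 0 c (h ▸ (hpl 0 c m c).2 (by ring))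
  -- `line m c` meets `l` only in `dir m`, so it is tangent there exactly when it avoids the affine
  -- part of `S`.
  have htan : ∀ m, m ≠ 0 → ∀ c, (∀ w ∈ W, w.2 ≠ c + m * w.1) ↔
      IsTangentAt S (dir m) (line m c) := by
    intro m hm c
    rw [isTangentAt_iff]
    constructor
    · intro h
      refine ⟨hdS m hm, hdl m c, fun p hpS hp => ?_⟩
      by_cases hpl' : p ∈ l
      · exact (ofField.eq_or_eq_of_orthogonal hp (hdl m c) hpl' (hdirl m hm).1).resolve_right (hll m c)
      · obtain ⟨x, y, rfl⟩ := hpt p hpl'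
        exact absurd ((hpl _ _ _ _).1 hp) (h (x, y) ((hWmem _ _).2 hpS))
    · rintro ⟨-, -, h⟩ ⟨x, y⟩ hw heq
      have := h _ ((hWmem _ _).1 hw) ((hpl _ _ _ _).2 heq)
      exact hptl x y (this ▸ (hdirl m hm).1)
  have hex : ∀ m, ∃ c, m ≠ 0 → IsTangentAt S (dir m) (line m c) := fun m => by
    by_cases hm : m = 0
    · exact ⟨0, fun h => absurd hm h⟩
    obtain ⟨t, ht, -⟩ := hS.existsUnique_tangent (hdS m hm)
    obtain ⟨c, rfl⟩ := hline m t (isTangentAt_iff.1 ht).2.1 fun h => hlt _ (h ▸ ht)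
    exact ⟨c, fun _ => ht⟩
  choose b hb using hex
  obtain ⟨x₀, y₀, h₀⟩ := missed_lines_concurrent W
    (by rw [← Nat.card_eq_fintype_card]; omega) b (fun m hm c => by
      rw [htan m hm]
      constructor
      · intro h
        have e := (hS.existsUnique_tangent (hdS m hm)).unique h (hb m hm)
        have : pt 0 c ∈ line m (b m) := e ▸ (hpl 0 c m c).2 (by ring)
        rw [hpl] at this
        linear_combination this
      · rintro rfl
        exact hb m hm)
  refine ⟨pt x₀ y₀, hptl _ _, fun p hpS hp t ht => ?_⟩
  obtain ⟨m, hm, rfl⟩ := hdir p hp ((hl p hp).1 hpS).1 ((hl p hp).1 hpS).2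
  rw [(hS.existsUnique_tangent hpS).unique ht (hb m hm), hpl]
  exact (h₀ m hm).symm

end Coordinates

/-! ### Incidence arguments in the triangle -/

section Triangle

open Configuration Configuration.Nondegenerate Configuration.HasPoints Configuration.HasLines

variable {P L : Type*} [Membership P L]

theorem isSecant_iff_ncard [Finite P] {k : ℕ} {S : Set P} {l : L} :
    IsSecant k S l ↔ {x | x ∈ S ∧ x ∈ l}.ncard = k := by
  rw [IsSecant, ← (Set.toFinite {x | x ∈ S ∧ x ∈ l}).cast_ncard_eq, Nat.cast_inj]

theorem isSecant_of_forall_mem_iff [Finite P] {q : ℕ} {S : Set P} {l : L} {A B : P} (hAB : A ≠ B)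
    (hA : A ∈ l) (hB : B ∈ l) (hl : ∀ p ∈ l, (p ∈ S ↔ p ≠ A ∧ p ≠ B))
    (hq : {p : P | p ∈ l}.ncard = q + 1) : IsSecant (q - 1) S l := by
  have h : {x | x ∈ S ∧ x ∈ l} = {p : P | p ∈ l} \ {A, B} := by
    ext x
    simp only [Set.mem_ofPred_eq, Set.mem_sdiff, Set.mem_insert_iff, Set.mem_singleton_iff, not_or]
    rw [and_comm]
    exact and_congr_right (hl x)
  have hsub : ({A, B} : Set P) ⊆ {p : P | p ∈ l} := by
    rintro x (rfl | rfl) <;> assumption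
  rw [isSecant_iff_ncard, h, Set.ncard_sdiff hsub, hq, Set.ncard_pair hAB]
  omega

theorem IsSecant.exists_two_not_mem [Finite P] {q : ℕ} {S : Set P} {l : L}
    (hl : IsSecant (q - 1) S l) (hq : {p : P | p ∈ l}.ncard = q + 1) (hq1 : 1 ≤ q) :
    ∃ A B : P, A ≠ B ∧ A ∈ l ∧ B ∈ l ∧ ∀ p ∈ l, (p ∈ S ↔ p ≠ A ∧ p ≠ B) := by
  rw [isSecant_iff_ncard] at hl
  have hsub : {x | x ∈ S ∧ x ∈ l} ⊆ {p : P | p ∈ l} := fun x hx => hx.2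
  have h := Set.ncard_sdiff hsub
  rw [hl, hq, show q + 1 - (q - 1) = 2 by omega] at h
  obtain ⟨A, B, hAB, h⟩ := Set.ncard_eq_two.1 h
  have h' : ∀ x, (x ∈ l ∧ x ∉ S) ↔ x = A ∨ x = B := fun x => by
    have := Set.ext_iff.1 h x
    simp only [Set.mem_ofPred_eq, Set.mem_sdiff, Set.mem_insert_iff,
      Set.mem_singleton_iff] at this
    tauto
  refine ⟨A, B, hAB, ((h' A).2 (Or.inl rfl)).1, ((h' B).2 (Or.inr rfl)).1, fun p hp => ?_⟩
  have := h' p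
  tauto

/-- Besides two given long secants that meet outside `S`, a small set has no long secant. -/
theorem encard_long_secants_eq_two [Finite P] [HasPoints P L] {q : ℕ} (hq : 3 ≤ q)
    {S : Set P} (hcard : 2 * S.ncard + 7 < 5 * q) {l a : L} (hla : l ≠ a)
    (hl : IsSecant (q - 1) S l) (ha : IsSecant (q - 1) S a) (hS : ∀ p ∈ S, p ∈ l → p ∉ a) :
    {m : L | IsSecant (q - 1) S m}.encard = 2 := by
  suffices h : {m : L | IsSecant (q - 1) S m} = {l, a} by rw [h, Set.encard_pair hla]
  ext m
  simp only [Set.mem_ofPred_eq, Set.mem_insert_iff, Set.mem_singleton_iff]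
  refine ⟨fun hm => ?_, by rintro (rfl | rfl) <;> assumption⟩
  by_contra! hne
  rw [isSecant_iff_ncard] at hl ha hm
  obtain ⟨hx, hx'⟩ := mkPoint_ax (P := P) hne.1
  obtain ⟨hy, hy'⟩ := mkPoint_ax (P := P) hne.2
  set x : P := mkPoint hne.1
  set y : P := mkPoint hne.2
  -- A third long secant adds at least q - 3 points to the 2(q - 1) on `l` and `a`; 3q - 5 ≤ |S|
  -- contradicts `hcard` once q ≥ 3.
  set R : Set P := {z | (z ∈ S ∧ z ∈ m) ∧ z ∉ l ∧ z ∉ a}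
  have h1 : {z | z ∈ S ∧ z ∈ m} ⊆ R ∪ {x, y} := by
    intro z hz
    by_cases hzl : z ∈ l
    · exact Or.inr (Or.inl ((eq_or_eq hz.2 hx hzl hx').resolve_right hne.1))
    by_cases hza : z ∈ a
    · exact Or.inr (Or.inr ((eq_or_eq hz.2 hy hza hy').resolve_right hne.2))
    exact Or.inl ⟨hz, hzl, hza⟩
  have h2 := (Set.ncard_le_ncard h1).trans (Set.ncard_union_le _ _)
  have h3 : ({x, y} : Set P).ncard ≤ 2 := (Set.ncard_insert_le _ _).trans (by rw [Set.ncard_singleton])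
  have h4 : ({z | z ∈ S ∧ z ∈ l} ∪ {z | z ∈ S ∧ z ∈ a}) ∪ R ⊆ S := by
    rintro z ((hz | hz) | hz)
    exacts [hz.1, hz.1, hz.1.1]
  have h5 := Set.ncard_le_ncard h4
  rw [Set.ncard_union_eq, Set.ncard_union_eq] at h5
  · omega
  · exact Set.disjoint_left.2 fun z hz hz' => hS z hz.1 hz.2 hz'.2
  · refine Set.disjoint_left.2 fun z hz hz' => ?_
    rcases hz with hz | hz
    exacts [hz'.2.1 hz.2, hz'.2.2 hz.2]

/-- If the tangents at the points of a long secant `AB` of a semioval all pass through `C`, then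
the semioval lies in the vertexless triangle `ABC`, and contains all of another side. -/
theorem IsSemioval.mem_sides_of_concurrent [HasPoints P L] [HasLines P L] {S : Set P} (hS : IsSemioval L S)
    {A B C : P} {l a b : L} (hAB : A ≠ B) (hAl : A ∈ l) (hBl : B ∈ l)
    (hl : ∀ p ∈ l, (p ∈ S ↔ p ≠ A ∧ p ≠ B)) (hCl : C ∉ l) (hCS : C ∉ S)
    (hBa : B ∈ a) (hCa : C ∈ a) (hAb : A ∈ b) (hCb : C ∈ b)
    (hC : ∀ p ∈ S, p ∈ l → ∀ t : L, IsTangentAt S p t → C ∈ t) :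
    (∀ x ∈ S, x ∈ a ∨ x ∈ b ∨ x ∈ l) ∧
      ((∀ p ∈ a, (p ∈ S ↔ p ≠ B ∧ p ≠ C)) ∨ (∀ p ∈ b, (p ∈ S ↔ p ≠ A ∧ p ≠ C))) := by
  have hAS : A ∉ S := fun h => ((hl A hAl).1 h).1 rfl
  have hBS : B ∉ S := fun h => ((hl B hBl).1 h).2 rfl
  have hal : a ≠ l := fun h => hCl (h ▸ hCa)
  have hbl : b ≠ l := fun h => hCl (h ▸ hCb)
  have hAa : A ∉ a := fun h => ((eq_or_eq h hBa hAl hBl).resolve_right hal) |> hAB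
  have hab : a ≠ b := fun h => hAa (h ▸ hAb)
  -- If `Cx` met `l` in a point of `S`, it would be the tangent there, yet it contains `x`. So it
  -- meets `l` in `A` or `B`.
  have hsides : ∀ x ∈ S, x ∈ a ∨ x ∈ b ∨ x ∈ l := by
    intro x hx
    by_cases hxl : x ∈ l
    · exact Or.inr (Or.inr hxl)
    have hxC : C ≠ x := fun h => hCS (h ▸ hx)
    obtain ⟨hCm, hxm⟩ := mkLine_ax (L := L) hxC
    set m : L := mkLine hxC
    have hml : m ≠ l := fun h => hCl (h ▸ hCm)
    obtain ⟨hpm, hpl⟩ := mkPoint_ax (P := P) hml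
    set p : P := mkPoint hml
    have hpC : p ≠ C := fun h => hCl (h ▸ hpl)
    by_cases hpA : p = A
    · rw [(eq_or_eq hAb hCb (hpA ▸ hpm) hCm).resolve_left (hpA ▸ hpC)]
      exact Or.inr (Or.inl hxm)
    by_cases hpB : p = B
    · rw [(eq_or_eq hBa hCa (hpB ▸ hpm) hCm).resolve_left (hpB ▸ hpC)]
      exact Or.inl hxm
    have hpS := (hl p hpl).2 ⟨hpA, hpB⟩
    obtain ⟨t, ht, -⟩ := hS.existsUnique_tangent hpS
    have hCt := hC p hpS hpl t ht
    rw [isTangentAt_iff] at ht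
    have htm := (eq_or_eq ht.2.1 hCt hpm hCm).resolve_left hpC
    have hxp := ht.2.2 x hx (htm ▸ hxm)
    exact absurd (hxp ▸ hpl) hxl
  refine ⟨hsides, ?_⟩
  -- If both sides have gaps `v` and `u`, the line `uv` meets `S` only on `l`, so it is a tangent
  -- there that avoids `C`.
  by_contra! hcon
  obtain ⟨⟨v, hva, hv⟩, u, hub, hu⟩ := hcon
  have hv' : v ∉ S ∧ v ≠ B ∧ v ≠ C := by
    rcases hv with ⟨hvS, h⟩ | h
    · refine absurd (h fun e => hBS (e ▸ hvS)) fun e => hCS (e ▸ hvS)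
    · exact h
  have hu' : u ∉ S ∧ u ≠ A ∧ u ≠ C := by
    rcases hu with ⟨huS, h⟩ | h
    · refine absurd (h fun e => hAS (e ▸ huS)) fun e => hCS (e ▸ huS)
    · exact h
  have huv : u ≠ v := fun h => hu'.2.2
    ((eq_or_eq (h ▸ hva : u ∈ a) hCa hub hCb).resolve_right hab)
  obtain ⟨hum, hvm⟩ := mkLine_ax (L := L) huv
  set m : L := mkLine huv
  have hmb : m ≠ b := fun h => hv'.2.2
    ((eq_or_eq hva hCa (h ▸ hvm) hCb).resolve_right hab)
  have hma : m ≠ a := fun h => hu'.2.2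
    ((eq_or_eq (h ▸ hum) hCa hub hCb).resolve_right hab)
  have hml : m ≠ l := fun h => hu'.2.1
    ((eq_or_eq (h ▸ hum) hAl hub hAb).resolve_right hbl.symm)
  obtain ⟨hpm, hpl⟩ := mkPoint_ax (P := P) hml
  set p : P := mkPoint hml
  have hpA : p ≠ A := fun h => hu'.2.1
    ((eq_or_eq hum (h ▸ hpm) hub hAb).resolve_right hmb)
  have hpB : p ≠ B := fun h => hv'.2.1
    ((eq_or_eq hvm (h ▸ hpm) hva hBa).resolve_right hma)
  have hpS := (hl p hpl).2 ⟨hpA, hpB⟩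
  have ht : IsTangentAt S p m := by
    rw [isTangentAt_iff]
    refine ⟨hpS, hpm, fun x hxS hxm => ?_⟩
    rcases hsides x hxS with hx | hx | hx
    · exact absurd (((eq_or_eq hxm hvm hx hva).resolve_right hma) ▸ hxS) hv'.1
    · exact absurd (((eq_or_eq hxm hum hx hub).resolve_right hmb) ▸ hxS) hu'.1
    · exact (eq_or_eq hxm hpm hx hpl).resolve_right hml
  exact hu'.2.2 ((eq_or_eq hum (hC p hpS hpl m ht) hub hCb).resolve_right hmb)

/-- For a single point, all of the at least three lines through it would be tangents. -/
theorem IsSemioval.one_lt_ncard [Finite P] [Finite L] [ProjectivePlane P L] {S : Set P}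
    (hS : IsSemioval L S) : 1 < S.ncard := by
  by_contra hlt
  obtain ⟨p, hp⟩ := hS.1
  have htan : ∀ l : L, p ∈ l → IsTangentAt S p l := fun l hl =>
    isTangentAt_iff.2 ⟨hp, hl, fun x hx _ =>
      (Set.ncard_le_one (Set.toFinite S)).1 (not_lt.1 hlt) x hx p hp⟩
  have h2 := ProjectivePlane.two_lt_lineCount (P := P) (L := L) p
  have : Nontrivial {l : L // p ∈ l} := Finite.one_lt_card_iff_nontrivial.1 (by
    rw [lineCount] at h2
    omega)
  obtain ⟨⟨l, hl⟩, ⟨m, hm⟩, hlm⟩ := exists_pair_ne {l : L // p ∈ l}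
  exact hlm (Subtype.ext ((hS.existsUnique_tangent hp).unique (htan l hl) (htan m hm)))

theorem ncard_points_on_line {K : Type*} [Field K] [Finite K] (l : PGLine K) :
    {p : PGPoint K | p ∈ l}.ncard = Nat.card K + 1 := by
  classical
  have := Fintype.ofFinite (PGPoint K)
  have h1 := ProjectivePlane.pointCount_eq (P := PGPoint K) (L := PGLine K) l
  have h2 := ProjectivePlane.card_points (PGPoint K) (PGLine K)
  rw [← Nat.card_eq_fintype_card, Projectivization.card_of_finrank (n := 3) K _ (by simp)] at h2
  simp only [Finset.sum_range_succ, Finset.sum_range_zero, pow_zero, pow_one, zero_add] at h2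
  have h3 : ProjectivePlane.order (PGPoint K) (PGLine K) = Nat.card K := by
    rcases lt_trichotomy (ProjectivePlane.order (PGPoint K) (PGLine K)) (Nat.card K) with h | h | h
    · nlinarith
    · exact h
    · nlinarith
  rw [← h3, ← h1, pointCount, ← Nat.card_coe_set_eq]
  rfl

end Triangle

/-! ### The main theorem -/

open Configuration Configuration.Nondegenerate Configuration.HasPoints Configuration.HasLines in
theorem corollary3p6 {K : Type*} [Field K] [Finite K] (q : ℕ) (hq : Nat.card K = q)
    (S : Set (PGPoint K)) (hS : IsSemioval (PGLine K) S)
    (l : PGLine K) (hl : IsSecant (q - 1) S l)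
    (hcard : (S.ncard : ℝ) < 5 * (q : ℝ) / 2 - 7 / 2) :
    (∃ T : Set (PGPoint K), IsVertexlessTriangle (PGLine K) T ∧ S ⊆ T) ∧
      {m : PGLine K | IsSecant (q - 1) S m}.encard = 2 := by
  classical
  have hcount : ∀ m : PGLine K, {p : PGPoint K | p ∈ m}.ncard = q + 1 :=
    fun m => hq ▸ ncard_points_on_line m
  have hcard' : 2 * S.ncard + 7 < 5 * q := by
    have : (2 * S.ncard + 7 : ℝ) < 5 * q := by linarith
    exact_mod_cast this
  have hS1 : 1 < S.ncard := hS.one_lt_ncard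
  have hq3 : 3 ≤ q := by omega
  obtain ⟨A, B, hAB, hA, hB, hlS⟩ := hl.exists_two_not_mem (hcount l) (by omega)
  have hlc := isSecant_iff_ncard.1 hl
  -- This needs q ≥ 3: for q = 2 a (q - 1)-secant is itself a tangent.
  have hlt : ∀ p, ¬ IsTangentAt S p l := fun p h => by
    rw [IsTangentAt] at h
    rw [h, Set.ncard_singleton] at hlc
    omega
  -- Removing the q - 1 points on `l` turns 2|S| + 7 < 5q into 2|W| + 6 ≤ 3q.
  have hdiff : S.ncard = (S \ {p | p ∈ l}).ncard + (q - 1) := by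
    rw [← hlc]
    exact (add_comm _ _).trans (Set.ncard_inter_add_ncard_sdiff_eq_ncard S {p | p ∈ l}) |>.symm
  obtain ⟨C, hCl, hC⟩ := tangents_concurrent hS hAB hA hB hlS hlt (by omega)
  -- A tangent at a point of `l` passes through `C`, so `C` in `S` would be its point of contact,
  -- which lies on `l`.
  have hCS : C ∉ S := fun h => by
    obtain ⟨p, hpS, hpl⟩ : {x | x ∈ S ∧ x ∈ l}.Nonempty :=
      Set.nonempty_of_ncard_ne_zero (by omega)
    obtain ⟨t, ht, -⟩ := hS.existsUnique_tangent hpS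
    exact hCl ((isTangentAt_iff.1 ht).2.2 C h (hC p hpS hpl t ht) ▸ hpl)
  have hAC : A ≠ C := fun h => hCl (h ▸ hA)
  have hBC : B ≠ C := fun h => hCl (h ▸ hB)
  obtain ⟨hAb, hCb⟩ := mkLine_ax (L := PGLine K) hAC
  obtain ⟨hBa, hCa⟩ := mkLine_ax (L := PGLine K) hBC
  set a : PGLine K := mkLine hBC
  set b : PGLine K := mkLine hAC
  have hla : l ≠ a := fun h => hCl (h ▸ hCa)
  have hlb : l ≠ b := fun h => hCl (h ▸ hCb)
  obtain ⟨hsides, hfull⟩ :=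
    hS.mem_sides_of_concurrent hAB hA hB hlS hCl hCS hBa hCa hAb hCb hC
  have hAS : A ∉ S := fun h => ((hlS A hA).1 h).1 rfl
  have hBS : B ∉ S := fun h => ((hlS B hB).1 h).2 rfl
  refine ⟨⟨_, ⟨A, B, C, a, b, l, ⟨fun h => ?_, hAb, hA⟩, ⟨hBa, fun h => ?_, hB⟩,
    ⟨hCa, hCb, hCl⟩, rfl⟩, fun x hx => ⟨hsides x hx, ?_⟩⟩, ?_⟩
  · exact hAB ((eq_or_eq h hBa hA hB).resolve_right hla.symm)
  · exact hAB ((eq_or_eq hAb h hA hB).resolve_right hlb.symm)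
  · rintro (rfl | rfl | rfl) <;> contradiction
  · rcases hfull with h | h
    · refine encard_long_secants_eq_two hq3 hcard' hla hl
        (isSecant_of_forall_mem_iff hBC hBa hCa h (hcount a)) fun p hpS hpl hpa => hBS ?_
      exact (eq_or_eq hpl hB hpa hBa).resolve_right hla ▸ hpS
    · refine encard_long_secants_eq_two hq3 hcard' hlb hl
        (isSecant_of_forall_mem_iff hAC hAb hCb h (hcount b)) fun p hpS hpl hpb => hAS ?_
      exact (eq_or_eq hpl hA hpb hAb).resolve_right hlb ▸ hpS
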